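/- Let $k\ge 1$ be an integer, and let $\delta>0$ and $c>0$ be real numbers. There exist a constant $C>0$ and an integer $p_0$, both depending only on $k$, $\delta$ and $c$, such that the following holds for every prime $p\ge p_0$. Let $\xi_1,\xi_2,\ldots$ be real numbers with $\xi_n\ge c$ for all $n\ge 1$, let $t$ be a real number with $p^{\delta}\le t\le p^{1-\delta}$, and for a Dirichlet character $\chi$ modulo $p$ put $$\Xi_p(\chi;t)=\sum_{1\le n\le t}\xi_n\,\chi(n).$$ Then $$\sum_{\substack{\chi \bmod p\\ \chi(-1)=1,\ \chi\ne\chi_0}}\bigl|\Xi_p(\chi;t)\bigr|^{2k}\ \ge\ C\,p\,t^{k/2}(\log p)^{(k-1)^2},$$ where $\chi_0$ is the principal character modulo $p$. -/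

import Mathlib

open scoped Classical in
/-- The even nonprincipal Dirichlet characters modulo `p`, i.e. the set `𝒳ₚ⁺ \ {χ₀}`. -/
noncomputable def evenNonprincipal (p : ℕ) [NeZero p] : Finset (DirichletCharacter ℂ p) :=
  Finset.univ.filter (fun χ => χ.Even ∧ χ ≠ 1)

/-- The Dirichlet polynomial `Ξₚ(χ; t) = ∑_{1 ≤ n ≤ t} ξₙ χ(n)` with real coefficients `ξₙ`. -/
noncomputable def dirichletPoly {p : ℕ} (ξ : ℕ → ℝ) (χ : DirichletCharacter ℂ p) (t : ℝ) : ℂ :=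
  ∑ n ∈ Finset.Icc 1 ⌊t⌋₊, (ξ n : ℂ) * χ (n : ZMod p)

/-!
The bound follows from orthogonality of characters and the power mean inequality.

Let `N = ⌊t⌋`. Detecting even characters by `(1 + χ(-1)) / 2`, orthogonality gives
`∑_{χ even} |Ξ(χ)|² = (p - 1) / 2 * ∑_{n ≤ N} ξₙ²` as soon as `2 N < p`, since `m ≡ -n` is then
impossible for `1 ≤ m, n ≤ N` (`sum_even_dirichletPoly_sq`). The principal character contributes
`(∑ ξₙ)² ≤ N ∑ ξₙ²` by Cauchy–Schwarz, which is negligible because `N` is small compared to `p`;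
no upper bound for the `ξₙ` is needed. So the second moment is at least a constant times `p t`
(`le_second_moment`).

There are at most `p` characters, so the power mean inequality turns this into a lower bound
`≫ p t ^ k` for the `2k`-th moment. As `t ≥ p ^ δ`, the factor `t ^ (k / 2)` exceeds any fixed power
of `log p` for large `p` (`eventually_log_pow_le`), and `t ^ k = t ^ (k / 2) * t ^ (k / 2)` gives the
claim.
-/

open Finset Filter

open scoped Classical in
/-- Second moment of a Dirichlet polynomial of length less than `p / 2` over all even characters,
principal one included. -/
theorem sum_even_dirichletPoly_sq (p : ℕ) [Fact p.Prime] (ξ : ℕ → ℝ) (t : ℝ)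
    (ht : 2 * ⌊t⌋₊ < p) :
    ∑ χ : DirichletCharacter ℂ p with χ.Even, ‖dirichletPoly ξ χ t‖ ^ 2 =
      ((p : ℝ) - 1) / 2 * ∑ n ∈ Icc 1 ⌊t⌋₊, ξ n ^ 2 := by
  have hp := Fact.out (p := p.Prime)
  have hφ : (p.totient : ℂ) = (p : ℂ) - 1 := by
    rw [Nat.totient_prime hp, Nat.cast_sub hp.one_le, Nat.cast_one]
  have hunit : ∀ n ∈ Icc 1 ⌊t⌋₊, IsUnit (n : ZMod p) := by
    intro n hn
    rw [mem_Icc] at hn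
    refine (ZMod.isUnit_iff_coprime n p).2 (Nat.Coprime.symm ?_)
    exact (Nat.Prime.coprime_iff_not_dvd hp).2 fun h => by
      have := Nat.le_of_dvd hn.1 h
      omega
  -- Doubling the sum with `χ(-m)` in place of `χ(m)` encodes the factor `(1 + χ(-1)) / 2`.
  have key : ∀ χ : DirichletCharacter ℂ p,
      (((if χ.Even then ‖dirichletPoly ξ χ t‖ ^ 2 else 0 : ℝ)) : ℂ) =
        ∑ n ∈ Icc 1 ⌊t⌋₊, ∑ m ∈ Icc 1 ⌊t⌋₊, ((ξ n : ℂ) * ξ m / 2) *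
          (χ (n : ZMod p)⁻¹ * χ (m : ZMod p) + χ (n : ZMod p)⁻¹ * χ (-(m : ZMod p))) := by
    intro χ
    have hsq : ((‖dirichletPoly ξ χ t‖ ^ 2 : ℝ) : ℂ) =
        ∑ n ∈ Icc 1 ⌊t⌋₊, ∑ m ∈ Icc 1 ⌊t⌋₊,
          ((ξ n : ℂ) * ξ m) * (χ (n : ZMod p)⁻¹ * χ (m : ZMod p)) := by
      rw [Complex.ofReal_pow, ← Complex.conj_mul', dirichletPoly, map_sum, sum_mul_sum]
      refine sum_congr rfl fun n _ => sum_congr rfl fun m _ => ?_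
      rw [map_mul, Complex.conj_ofReal, ← MulChar.inv_apply', ← MulChar.star_apply']
      simp only [Complex.star_def]
      ring
    rcases χ.even_or_odd with h | h
    · rw [if_pos h, hsq]
      refine sum_congr rfl fun n _ => sum_congr rfl fun m _ => ?_
      rw [h.eval_neg]
      ring
    · have hne : ¬ χ.Even := fun h' => by
        have h1 : χ (-1) = 1 := h'
        have h2 : χ (-1) = -1 := h
        rw [h1] at h2
        norm_num at h2
      rw [if_neg hne, Complex.ofReal_zero]
      refine (sum_eq_zero fun n _ => sum_eq_zero fun m _ => ?_).symm
      rw [h.eval_neg]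
      ring
  have hC : ((∑ χ : DirichletCharacter ℂ p with χ.Even, ‖dirichletPoly ξ χ t‖ ^ 2 : ℝ) : ℂ) =
      ((((p : ℝ) - 1) / 2 * ∑ n ∈ Icc 1 ⌊t⌋₊, ξ n ^ 2 : ℝ) : ℂ) := by
    rw [sum_filter, Complex.ofReal_sum]
    simp_rw [key]
    rw [sum_comm, Complex.ofReal_mul, Complex.ofReal_sum, mul_sum]
    refine sum_congr rfl fun n hn => ?_
    rw [sum_comm]
    simp_rw [← mul_sum, sum_add_distrib,
      DirichletCharacter.sum_char_inv_mul_char_eq ℂ (hunit n hn)]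
    rw [sum_eq_single_of_mem n hn]
    · have hneg : ¬ ((n : ZMod p) = -(n : ZMod p)) := by
        intro h
        rw [eq_neg_iff_add_eq_zero, ← Nat.cast_add, ZMod.natCast_eq_zero_iff] at h
        rw [mem_Icc] at hn
        have := Nat.le_of_dvd (by omega) h
        omega
      rw [if_pos rfl, if_neg hneg, hφ]
      push_cast
      ring
    · intro m hm hmn
      rw [mem_Icc] at hm hn
      have hne : ¬ ((n : ZMod p) = (m : ZMod p)) := by
        rw [ZMod.natCast_eq_natCast_iff']
        rw [Nat.mod_eq_of_lt (by omega), Nat.mod_eq_of_lt (by omega)]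
        exact fun h => hmn h.symm
      have hneg : ¬ ((n : ZMod p) = -(m : ZMod p)) := by
        intro h
        rw [eq_neg_iff_add_eq_zero, ← Nat.cast_add, ZMod.natCast_eq_zero_iff] at h
        have := Nat.le_of_dvd (by omega) h
        omega
      rw [if_neg hne, if_neg hneg]
      simp
  exact_mod_cast hC

theorem norm_dirichletPoly_one_sq_le (p : ℕ) [Fact p.Prime] (ξ : ℕ → ℝ) (t : ℝ) :
    ‖dirichletPoly ξ (1 : DirichletCharacter ℂ p) t‖ ^ 2 ≤
      ⌊t⌋₊ * ∑ n ∈ Icc 1 ⌊t⌋₊, ξ n ^ 2 := by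
  have h : ‖dirichletPoly ξ (1 : DirichletCharacter ℂ p) t‖ ≤ ∑ n ∈ Icc 1 ⌊t⌋₊, |ξ n| := by
    refine norm_sum_le_of_le _ fun n _ => ?_
    rw [norm_mul, Complex.norm_real, Real.norm_eq_abs]
    exact mul_le_of_le_one_right (abs_nonneg _) (DirichletCharacter.norm_le_one _ _)
  calc _ ≤ (∑ n ∈ Icc 1 ⌊t⌋₊, |ξ n|) ^ 2 := by gcongr
    _ ≤ #(Icc 1 ⌊t⌋₊) * ∑ n ∈ Icc 1 ⌊t⌋₊, |ξ n| ^ 2 := sq_sum_le_card_mul_sum_sq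
    _ = _ := by simp [sq_abs]

theorem le_second_moment (p : ℕ) [Fact p.Prime] (hp4 : 4 ≤ p) {c : ℝ} (hc : 0 < c) {ξ : ℕ → ℝ}
    (hξ : ∀ n, 1 ≤ n → c ≤ ξ n) {t : ℝ} (ht1 : 1 ≤ t) (htp : 4 * t ≤ p) :
    c ^ 2 / 16 * (p * t) ≤ ∑ χ ∈ evenNonprincipal p, ‖dirichletPoly ξ χ t‖ ^ 2 := by
  classical
  have hN : (⌊t⌋₊ : ℝ) ≤ t := Nat.floor_le (by linarith)
  have hN1 : (1 : ℝ) ≤ ⌊t⌋₊ := by exact_mod_cast (Nat.one_le_floor_iff t).2 ht1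
  have hN2 : t / 2 ≤ ⌊t⌋₊ := by linarith [Nat.lt_floor_add_one t]
  have hp4' : (4 : ℝ) ≤ p := by exact_mod_cast hp4
  have h2N : 2 * ⌊t⌋₊ < p := by
    have : (2 * ⌊t⌋₊ : ℝ) < p := by linarith
    exact_mod_cast this
  have hsplit : ∑ χ ∈ evenNonprincipal p, ‖dirichletPoly ξ χ t‖ ^ 2 +
      ‖dirichletPoly ξ (1 : DirichletCharacter ℂ p) t‖ ^ 2 =
        ∑ χ : DirichletCharacter ℂ p with χ.Even, ‖dirichletPoly ξ χ t‖ ^ 2 := by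
    have hmem : (1 : DirichletCharacter ℂ p) ∈
        ({χ : DirichletCharacter ℂ p | χ.Even} : Finset _) := by
      rw [mem_filter]
      exact ⟨mem_univ _, MulChar.one_apply isUnit_one.neg⟩
    rw [← sum_erase_add _ _ hmem]
    congr 2
    ext χ
    simp [evenNonprincipal, and_comm]
  have hsum : c ^ 2 * (t / 2) ≤ ∑ n ∈ Icc 1 ⌊t⌋₊, ξ n ^ 2 := by
    calc c ^ 2 * (t / 2) ≤ c ^ 2 * ⌊t⌋₊ := by gcongr
      _ = ∑ n ∈ Icc 1 ⌊t⌋₊, c ^ 2 := by simp [mul_comm]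
      _ ≤ _ := sum_le_sum fun n hn => by
        have := hξ n (mem_Icc.1 hn).1
        gcongr
  have h1 := norm_dirichletPoly_one_sq_le p ξ t
  rw [sum_even_dirichletPoly_sq p ξ t h2N] at hsplit
  have h3 : (p : ℝ) / 8 * (c ^ 2 * (t / 2)) ≤
      (((p : ℝ) - 1) / 2 - ⌊t⌋₊) * ∑ n ∈ Icc 1 ⌊t⌋₊, ξ n ^ 2 := by
    apply mul_le_mul _ hsum (by positivity) <;> linarith
  linarith

theorem card_evenNonprincipal_le (p : ℕ) [Fact p.Prime] : #(evenNonprincipal p) ≤ p := by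
  calc #(evenNonprincipal p) ≤ Fintype.card (DirichletCharacter ℂ p) := card_le_univ _
    _ = p.totient := by
      rw [← Nat.card_eq_fintype_card,
        DirichletCharacter.card_eq_totient_of_hasEnoughRootsOfUnity ℂ p]
    _ ≤ p := Nat.totient_le p

theorem eventually_log_pow_le {ε : ℝ} (hε : 0 < ε) (M : ℕ) :
    ∀ᶠ n : ℕ in atTop, Real.log n ^ M ≤ (n : ℝ) ^ ε := by
  have h := ((isLittleO_log_rpow_rpow_atTop (M : ℝ) hε).bound one_pos).and
    (eventually_ge_atTop 1)
  filter_upwards [tendsto_natCast_atTop_atTop.eventually h] with n hn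
  have h0 : (0 : ℝ) ≤ (n : ℝ) ^ ε := by positivity
  have h1 := hn.1
  rw [one_mul, Real.rpow_natCast, Real.norm_of_nonneg h0] at h1
  exact (le_abs_self _).trans h1

theorem theorem1p6 (k : ℕ) (hk : 1 ≤ k) (δ : ℝ) (hδ : 0 < δ) (c : ℝ) (hc : 0 < c) :
    ∃ C : ℝ, 0 < C ∧ ∃ p₀ : ℕ, ∀ (p : ℕ) [Fact p.Prime], p₀ ≤ p →
      ∀ ξ : ℕ → ℝ, (∀ n : ℕ, 1 ≤ n → c ≤ ξ n) →
        ∀ t : ℝ, (p : ℝ) ^ δ ≤ t → t ≤ (p : ℝ) ^ (1 - δ) →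
          C * ((p : ℝ) * t ^ ((k : ℝ) / 2) * Real.log (p : ℝ) ^ ((k - 1) ^ 2)) ≤
            ∑ χ ∈ evenNonprincipal p, ‖dirichletPoly ξ χ t‖ ^ (2 * k) := by
  have hk0 : (0 : ℝ) < k := by exact_mod_cast hk
  have hlarge : ∀ᶠ n : ℕ in atTop, (4 : ℝ) ≤ (n : ℝ) ^ δ :=
    ((tendsto_rpow_atTop hδ).comp tendsto_natCast_atTop_atTop).eventually_ge_atTop 4
  -- `p ^ δ ≥ 4` makes `t ≤ p ^ (1 - δ)` at most `p / 4`, so that `le_second_moment` applies.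
  obtain ⟨p₀, hp₀⟩ := eventually_atTop.1 ((hlarge.and (eventually_ge_atTop 4)).and
    (eventually_log_pow_le (show 0 < δ * (k / 2) by positivity) ((k - 1) ^ 2)))
  refine ⟨(c ^ 2 / 16) ^ k, by positivity, p₀, fun p _ hp ξ hξ t ht1 ht2 => ?_⟩
  obtain ⟨⟨hpδ, hp4⟩, hlog⟩ := hp₀ p hp
  have hp0 : (0 : ℝ) < p := by exact_mod_cast (by omega : 0 < p)
  have ht : 4 ≤ t := hpδ.trans ht1
  have htp : 4 * t ≤ p := by
    calc 4 * t ≤ (p : ℝ) ^ δ * (p : ℝ) ^ (1 - δ) := by gcongr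
      _ = p := by rw [← Real.rpow_add hp0]; simp
  have hlogt : Real.log p ^ ((k - 1) ^ 2) ≤ t ^ ((k : ℝ) / 2) := by
    refine hlog.trans ?_
    rw [Real.rpow_mul hp0.le]
    gcongr
  have htk : t ^ ((k : ℝ) / 2) * t ^ ((k : ℝ) / 2) = t ^ k := by
    rw [← Real.rpow_add (by linarith), add_halves, Real.rpow_natCast]
  obtain ⟨m, rfl⟩ : ∃ m, k = m + 1 := ⟨k - 1, by omega⟩
  have hmoment := le_second_moment p hp4 hc hξ (by linarith) htp
  have hmean : (c ^ 2 / 16 * (p * t)) ^ (m + 1) ≤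
      (p : ℝ) ^ m * ∑ χ ∈ evenNonprincipal p, ‖dirichletPoly ξ χ t‖ ^ (2 * (m + 1)) := by
    calc (c ^ 2 / 16 * (p * t)) ^ (m + 1)
        ≤ (∑ χ ∈ evenNonprincipal p, ‖dirichletPoly ξ χ t‖ ^ 2) ^ (m + 1) := by gcongr
      _ ≤ (#(evenNonprincipal p) : ℝ) ^ m *
          ∑ χ ∈ evenNonprincipal p, (‖dirichletPoly ξ χ t‖ ^ 2) ^ (m + 1) :=
        pow_sum_le_card_mul_sum_pow (fun _ _ => by positivity) m
      _ ≤ _ := by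
        simp_rw [← pow_mul]
        gcongr
        exact card_evenNonprincipal_le p
  refine le_of_mul_le_mul_left (le_trans ?_ hmean) (pow_pos hp0 m)
  calc (p : ℝ) ^ m * ((c ^ 2 / 16) ^ (m + 1) * (p * t ^ (((m + 1 : ℕ) : ℝ) / 2) *
          Real.log p ^ ((m + 1 - 1) ^ 2)))
      ≤ (p : ℝ) ^ m * ((c ^ 2 / 16) ^ (m + 1) * (p * t ^ (((m + 1 : ℕ) : ℝ) / 2) *
          t ^ (((m + 1 : ℕ) : ℝ) / 2))) := by gcongr
    _ = (c ^ 2 / 16 * (p * t)) ^ (m + 1) := by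
      rw [mul_assoc (p : ℝ), htk]
      ring
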